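/- Let $\lambda>\aleph_1$ be a regular cardinal. Let $\mathcal M_\lambda$ be the class of isometry types of metric spaces of cardinality $\lambda$, quasi-ordered by bi-Lipschitz embeddability: $X\le_{BL}Y$ if and only if there are a constant $K>0$ and an injection $f:X\to Y$ such that $d_Y(f(x_1),f(x_2))<K\,d_X(x_1,x_2)$ and $d_X(x_1,x_2)<K\,d_Y(f(x_1),f(x_2))$ for all distinct $x_1,x_2\in X$. Let $[\mathcal P(\mathbb N)]^{\le\lambda}$ be the set of all families $\mathcal A\subseteq\mathcal P(\mathbb N)$ with $|\mathcal A|\le\lambda$, ordered by inclusion. Then there is an order preserving map $$F:(\mathcal M_\lambda,\le_{BL})\to([\mathcal P(\mathbb N)]^{\le\lambda},\subseteq),$$ that is, $X\le_{BL}Y$ implies $F(X)\subseteq F(Y)$, such that the image under $F$ of the ultrametric spaces is cofinal in $([\mathcal P(\mathbb N)]^{\le\lambda},\subseteq)$: for every family $\mathcal A\subseteq\mathcal P(\mathbb N)$ with $|\mathcal A|\le\lambda$ there is an ultrametric space $X$ of cardinality $\lambda$ with $\mathcal A\subseteq F(X)$. -/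

import Mathlib

open scoped Cardinal

universe u

/-- `f` satisfies the Lipschitz condition with constant `K` and so does `f⁻¹` (defined on the
range of `f`), where the inequalities are strict and are required for distinct points. -/
def IsBiLipschitzEmbedding {X Y : Type*} [MetricSpace X] [MetricSpace Y] (K : ℝ) (f : X → Y) :
    Prop :=
  0 < K ∧ Function.Injective f ∧
    ∀ x₁ x₂ : X, x₁ ≠ x₂ →
      dist (f x₁) (f x₂) < K * dist x₁ x₂ ∧ dist x₁ x₂ < K * dist (f x₁) (f x₂)

/-- `X` is bi-Lipschitz embeddable into `Y`: some map is a bi-Lipschitz embedding, with some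
constant. -/
def BiLipschitzEmbeddable (X Y : Type*) [MetricSpace X] [MetricSpace Y] : Prop :=
  ∃ (K : ℝ) (f : X → Y), IsBiLipschitzEmbedding K f

theorem BiLipschitzEmbeddable.of_isometryEquiv {X Y : Type*} [MetricSpace X] [MetricSpace Y]
    (e : X ≃ᵢ Y) : BiLipschitzEmbeddable X Y := by
  refine ⟨2, e, by norm_num, e.injective, fun x₁ x₂ h => ?_⟩
  have h0 : 0 < dist x₁ x₂ := dist_pos.2 h
  rw [e.isometry.dist_eq]
  constructor <;> linarith

theorem BiLipschitzEmbeddable.trans {X Y Z : Type*} [MetricSpace X] [MetricSpace Y]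
    [MetricSpace Z] (h₁ : BiLipschitzEmbeddable X Y) (h₂ : BiLipschitzEmbeddable Y Z) :
    BiLipschitzEmbeddable X Z := by
  obtain ⟨K, f, hK, hf, hfd⟩ := h₁
  obtain ⟨L, g, hL, hg, hgd⟩ := h₂
  refine ⟨K * L, g ∘ f, mul_pos hK hL, hg.comp hf, fun x₁ x₂ h => ?_⟩
  obtain ⟨a, b⟩ := hfd x₁ x₂ h
  obtain ⟨c, d⟩ := hgd (f x₁) (f x₂) (hf.ne h)
  simp only [Function.comp]
  constructor
  · nlinarith [mul_lt_mul_of_pos_left a hL]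
  · nlinarith [mul_lt_mul_of_pos_left d hK]

/-- A metric space whose underlying set has cardinality `κ`. -/
structure MetricSpaceOfCard (κ : Cardinal.{u}) where
  carrier : Type u
  [metric : MetricSpace carrier]
  card_eq : #carrier = κ

attribute [instance] MetricSpaceOfCard.metric

/-- Being isometric, as an equivalence relation on the metric spaces of cardinality `κ`. -/
instance MetricSpaceOfCard.isometricSetoid (κ : Cardinal.{u}) : Setoid (MetricSpaceOfCard κ) where
  r X Y := Nonempty (X.carrier ≃ᵢ Y.carrier)
  iseqv :=
    { refl := fun X => ⟨IsometryEquiv.refl X.carrier⟩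
      symm := fun ⟨e⟩ => ⟨e.symm⟩
      trans := fun ⟨e⟩ ⟨e'⟩ => ⟨e.trans e'⟩ }

/-- The isometry types of metric spaces of cardinality `κ`. -/
def MetricTypes (κ : Cardinal.{u}) : Type (u + 1) :=
  Quotient (MetricSpaceOfCard.isometricSetoid κ)

/-- The isometry type of a metric space of cardinality `κ`. -/
def MetricSpaceOfCard.isometryType {κ : Cardinal.{u}} (X : MetricSpaceOfCard κ) : MetricTypes κ :=
  Quotient.mk (MetricSpaceOfCard.isometricSetoid κ) X

/-- The quasi-order of bi-Lipschitz embeddability on isometry types. -/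
instance MetricTypes.instPreorder (κ : Cardinal.{u}) : Preorder (MetricTypes κ) where
  le := Quotient.lift₂ (fun X Y => BiLipschitzEmbeddable X.carrier Y.carrier) <| by
    rintro X Y X' Y' ⟨e⟩ ⟨e'⟩
    refine propext ⟨fun h => ?_, fun h => ?_⟩
    · exact (BiLipschitzEmbeddable.of_isometryEquiv e.symm).trans
        (h.trans (BiLipschitzEmbeddable.of_isometryEquiv e'))
    · exact (BiLipschitzEmbeddable.of_isometryEquiv e).trans
        (h.trans (BiLipschitzEmbeddable.of_isometryEquiv e'.symm))
  le_refl := by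
    rintro ⟨X⟩
    exact BiLipschitzEmbeddable.of_isometryEquiv (IsometryEquiv.refl X.carrier)
  le_trans := by
    rintro ⟨X⟩ ⟨Y⟩ ⟨Z⟩ h₁ h₂
    exact BiLipschitzEmbeddable.trans h₁ h₂

theorem MetricSpaceOfCard.isometryType_le_iff {κ : Cardinal.{u}} (X Y : MetricSpaceOfCard κ) :
    X.isometryType ≤ Y.isometryType ↔ BiLipschitzEmbeddable X.carrier Y.carrier :=
  Iff.rfl

/-- The isometry types of the ultrametric spaces of cardinality `κ`. -/
def ultrametricTypes (κ : Cardinal.{u}) : Set (MetricTypes κ) :=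
  {m | ∃ X : MetricSpaceOfCard κ, IsUltrametricDist X.carrier ∧ X.isometryType = m}

/-- The families of at most `κ` subsets of `ℕ`; as a subtype of `Set (Set ℕ)` it is ordered by
inclusion. -/
abbrev RealFamilies (κ : Cardinal.{u}) : Type :=
  {S : Set (Set ℕ) // Cardinal.lift.{u} #S ≤ κ}

/-! Enumerate X in order type λ and let X_a be the set of points of rank below a. A bi-Lipschitz f :
X → Y satisfies d(x, X_a) ≈ d(f x, Y_a), with a uniform constant, for all x and all a in a club: f
maps X_a into Y_a, and f(X_a) approximates the distances from points of Y_a to f(X). The rate at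
which x is approached along a ladder inside this club is therefore preserved. Club guessing,
available because λ > ℵ₁, fixes ladders `c δ` in advance such that every club contains one. Encode A
⊆ ℕ by a real ρ(A) in (0,1), and put A in F(X) if every club contains some `c δ` along which some
point is approached like ρ(A)^n. A pair (δ, x) determines its rate, so |F(X)| ≤ λ. For cofinality,
an ultrametric space of sequences over λ is used: the first entry i selects the base ρ(φ i), and i
followed by a guessing ladder is approached at exactly that rate. Clubs are represented by
`closurePoints g`. -/

/-- The points `a` such that the initial segment below `a` is closed under `g`. -/
def closurePoints {Λ : Type*} [LT Λ] (g : Λ → Λ) : Set Λ :=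
  {a | ∀ b < a, g b < a}

/-! ### Clubs of closure points and club guessing -/

section ClubGuessing

variable {Λ : Type u} [LinearOrder Λ]

theorem exists_forall_lt_of_mk_lt_cof {s : Set Λ} (hs : #s < Order.cof Λ) :
    ∃ b, ∀ x ∈ s, x < b := by
  have h : ¬ IsCofinal s := fun h => (Order.cof_le h).not_gt hs
  simpa [IsCofinal] using h

theorem exists_forall_lt_of_countable (h0 : ℵ₀ < Order.cof Λ) {s : Set Λ} (hs : s.Countable) :
    ∃ b, ∀ x ∈ s, x < b :=
  exists_forall_lt_of_mk_lt_cof (hs.le_aleph0.trans_lt h0)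

theorem mk_Iic_lt_cof (h0 : ℵ₀ < Order.cof Λ) (hI : ∀ a : Λ, #(Set.Iio a) < Order.cof Λ) (a : Λ) :
    #(Set.Iic a) < Order.cof Λ := by
  obtain ⟨b, hb⟩ := exists_forall_lt_of_countable h0 (Set.countable_singleton a)
  exact (Cardinal.mk_le_mk_of_subset fun x hx => lt_of_le_of_lt hx (hb a rfl)).trans_lt (hI b)

/-- A least upper bound of closure points is a closure point. -/
theorem mem_closurePoints_of_isLUB {g : Λ → Λ} {s : Set Λ} (hs : s ⊆ closurePoints g) {a : Λ}
    (ha : IsLUB s a) : a ∈ closurePoints g := fun b hb => by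
  obtain ⟨e, he, hbe⟩ := (lt_isLUB_iff ha).1 hb
  exact (hs he b hbe).trans_le (ha.1 he)

theorem closurePoints_anti {g h : Λ → Λ} (hgh : ∀ b, g b ≤ h b) :
    closurePoints h ⊆ closurePoints g :=
  fun _ ha b hb => (hgh b).trans_lt (ha b hb)

/-- Any operator on functions can be iterated along `W`, with pointwise suprema: each function
of the sequence dominates its predecessors and their images. -/
theorem exists_iterate_operator {W : Type u} [LinearOrder W] [WellFoundedLT W]
    (hW : #W < Order.cof Λ) (H : (Λ → Λ) → Λ → Λ) :
    ∃ G : W → Λ → Λ, ∀ i j, i < j → ∀ b, G i b ≤ G j b ∧ H (G i) b ≤ G j b := by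
  have key : ∀ (i : W) (G : ∀ j < i, Λ → Λ), ∃ g : Λ → Λ, ∀ j (hj : j < i) b,
      G j hj b ≤ g b ∧ H (G j hj) b ≤ g b := by
    intro i G
    have : ∀ b, ∃ c, ∀ j (hj : j < i), G j hj b ≤ c ∧ H (G j hj) b ≤ c := by
      intro b
      have hc : ∀ f : Set.Iio i → Λ, ∃ c, ∀ j, f j < c := fun f => by
        obtain ⟨c, hc⟩ := exists_forall_lt_of_mk_lt_cof (s := Set.range f)
          ((Cardinal.mk_range_le.trans (Cardinal.mk_set_le _)).trans_lt hW)
        exact ⟨c, fun j => hc _ ⟨j, rfl⟩⟩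
      obtain ⟨c, hc1⟩ := hc fun j => G j.1 j.2 b
      obtain ⟨d, hd1⟩ := hc fun j => H (G j.1 j.2) b
      exact ⟨max c d, fun j hj => ⟨(hc1 ⟨j, hj⟩).le.trans (le_max_left _ _),
        (hd1 ⟨j, hj⟩).le.trans (le_max_right _ _)⟩⟩
    choose g hg using this
    exact ⟨g, fun j hj b => hg b j hj⟩
  choose next hnext using key
  refine ⟨wellFounded_lt.fix next, fun i j hij b => ?_⟩
  rw [wellFounded_lt.fix_eq next j]
  exact hnext j (fun k _ => wellFounded_lt.fix next k) i hij b

theorem exists_strictMono_comp_of_forall_exists_lt {u : ℕ → Λ} (hu : ∀ n, ∃ m > n, u n < u m) :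
    ∃ φ : ℕ → ℕ, StrictMono (u ∘ φ) := by
  choose s _ hs using hu
  exact ⟨fun n => s^[n] 0, strictMono_nat_of_lt_succ fun n => by
    simpa only [Function.comp, Function.iterate_succ_apply'] using hs _⟩

variable [WellFoundedLT Λ]

theorem exists_isLeast_of_nonempty {s : Set Λ} (hs : s.Nonempty) : ∃ a, IsLeast s a :=
  ⟨wellFounded_lt.min s hs, wellFounded_lt.min_mem s hs,
    fun _ hx => not_lt.1 (wellFounded_lt.not_lt_min s hx)⟩

/-- The least strict upper bound of an ω-chain in which each term bounds the values of g up to its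
predecessor is closed under g. -/
theorem exists_gt_mem_closurePoints (h0 : ℵ₀ < Order.cof Λ)
    (hI : ∀ a : Λ, #(Set.Iio a) < Order.cof Λ) (g : Λ → Λ) (c : Λ) :
    ∃ a ∈ closurePoints g, c < a := by
  have step : ∀ x : Λ, ∃ y, x < y ∧ ∀ b ≤ x, g b < y := by
    intro x
    obtain ⟨y, hy⟩ := exists_forall_lt_of_mk_lt_cof (s := g '' Set.Iic x)
      (Cardinal.mk_image_le.trans_lt (mk_Iic_lt_cof h0 hI x))
    obtain ⟨z, hz⟩ := exists_forall_lt_of_countable h0 (Set.countable_singleton x)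
    exact ⟨max y z, (hz x rfl).trans_le (le_max_right _ _),
      fun b hb => (hy _ ⟨b, hb, rfl⟩).trans_le (le_max_left _ _)⟩
  choose s hs hsg using step
  obtain ⟨b, hb⟩ := exists_forall_lt_of_countable h0 (Set.countable_range fun n => s^[n] c)
  obtain ⟨a, ha, hmin⟩ := exists_isLeast_of_nonempty (s := {a | ∀ n, s^[n] c < a})
    ⟨b, fun n => hb _ ⟨n, rfl⟩⟩
  refine ⟨a, fun x hx => ?_, ha 0⟩
  have : ∃ n, x ≤ s^[n] c := by
    by_contra! h
    exact (hmin h).not_gt hx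
  obtain ⟨n, hn⟩ := this
  have := ha (n + 1)
  rw [Function.iterate_succ_apply'] at this
  exact (hsg _ _ hn).trans this

/-- Closure points are closed under suprema. The empty supremum causes no trouble: the least element
is vacuously a closure point. -/
theorem exists_isGreatest_closurePoints_inter_Iic (g : Λ → Λ) (a : Λ) :
    ∃ b, IsGreatest (closurePoints g ∩ Set.Iic a) b := by
  obtain ⟨m, -, hm⟩ := exists_isLeast_of_nonempty (s := (Set.univ : Set Λ)) ⟨a, trivial⟩
  obtain ⟨b, hb, hmin⟩ := exists_isLeast_of_nonempty
    (s := upperBounds (closurePoints g ∩ Set.Iic a)) ⟨a, fun x hx => hx.2⟩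
  have hlub : IsLUB (closurePoints g ∩ Set.Iic a) b := ⟨hb, hmin⟩
  exact ⟨b, ⟨mem_closurePoints_of_isLUB Set.inter_subset_left hlub, hmin fun x hx => hx.2⟩, hb⟩

/-- The greatest closure point of `g` that is at most `a`. -/
noncomputable def lastClosurePoint (g : Λ → Λ) (a : Λ) : Λ :=
  (exists_isGreatest_closurePoints_inter_Iic g a).choose

theorem isGreatest_lastClosurePoint (g : Λ → Λ) (a : Λ) :
    IsGreatest (closurePoints g ∩ Set.Iic a) (lastClosurePoint g a) :=
  (exists_isGreatest_closurePoints_inter_Iic g a).choose_spec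

/-- Countably many antitone functions from an order of uncountable cofinality to a well-order are
constant from a common point on. -/
theorem exists_forall_ge_eq_of_antitone {W : Type u} [LinearOrder W] [Nonempty W]
    (hW : ℵ₀ < Order.cof W) (f : ℕ → W → Λ) (hf : ∀ n, Antitone (f n)) :
    ∃ i, ∀ n, ∀ j ≥ i, f n j = f n i := by
  have : ∀ n, ∃ i, ∀ j ≥ i, f n j = f n i := by
    intro n
    obtain ⟨a, ⟨i, rfl⟩, hmin⟩ := exists_isLeast_of_nonempty (Set.range_nonempty (f n))
    exact ⟨i, fun j hj => le_antisymm (hf n hj) (hmin ⟨j, rfl⟩)⟩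
  choose i hi using this
  obtain ⟨k, hk⟩ := exists_forall_lt_of_countable hW (Set.countable_range i)
  have hk' : ∀ n, i n ≤ k := fun n => (hk _ ⟨n, rfl⟩).le
  exact ⟨k, fun n j hj => by rw [hi n j ((hk' n).trans hj), hi n k (hk' n)]⟩

/-- Club guessing, at points of countable cofinality. -/
theorem exists_club_guessing (h1 : ℵ₁ < Order.cof Λ)
    (hI : ∀ a : Λ, #(Set.Iio a) < Order.cof Λ) :
    ∃ c : Λ → ℕ → Λ, ∀ g : Λ → Λ, ∃ δ, StrictMono (c δ) ∧ ∀ n, c δ n ∈ closurePoints g := by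
  classical
  by_contra! hcon
  have h0 : ℵ₀ < Order.cof Λ := Cardinal.aleph0_lt_aleph_one.trans h1
  -- a ladder system
  let ladder : Λ → ℕ → Λ := fun δ =>
    if h : ∃ η : ℕ → Λ, StrictMono η ∧ IsLUB (Set.range η) δ then h.choose else fun _ => δ
  -- Each rung is pushed down into the club of g, and the result is thinned to be strictly
  -- increasing. The constant default is not strictly monotone, so it never counts as a guess.
  let refined : (Λ → Λ) → Λ → ℕ → Λ := fun g δ =>
    if h : ∃ φ : ℕ → ℕ, StrictMono ((fun n => lastClosurePoint g (ladder δ n)) ∘ φ) then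
      (fun n => lastClosurePoint g (ladder δ n)) ∘ h.choose
    else fun _ => δ
  -- If guessing fails, `H g` gives a club that contains none of the strictly increasing ladders
  -- refined by g.
  choose H hH using fun g : Λ → Λ => hcon (refined g)
  -- Length ω₁ is short enough for suprema in Λ and long enough for countably many descending
  -- sequences to stabilize together.
  let W := (Cardinal.aleph 1 : Cardinal.{u}).ord.ToType
  have hWreg : Order.cof W = ℵ₁ := by
    rw [Ordinal.cof_toType, Cardinal.isRegular_aleph_one.cof_ord]
  have hWcof : ℵ₀ < Order.cof W := by
    rw [hWreg]
    exact Cardinal.aleph0_lt_aleph_one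
  have : Nonempty W := Order.cof_ne_zero_iff.1 (bot_lt_of_lt hWcof).ne'
  have hWcard : #W < Order.cof Λ := by rwa [Cardinal.mk_ord_toType]
  obtain ⟨G, hG⟩ := exists_iterate_operator hWcard H
  have hGmono : ∀ i j, i ≤ j → closurePoints (G j) ⊆ closurePoints (G i) := by
    intro i j hij
    rcases hij.eq_or_lt with rfl | hij
    · exact subset_rfl
    · exact closurePoints_anti fun b => (hG i j hij b).1
  have : ∀ b, ∃ c, ∀ i, G i b < c := fun b => by
    obtain ⟨c, hc⟩ := exists_forall_lt_of_mk_lt_cof (s := Set.range fun i => G i b)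
      (Cardinal.mk_range_le.trans_lt hWcard)
    exact ⟨c, fun i => hc _ ⟨i, rfl⟩⟩
  choose Ginf hGinf using this
  have hGinf' : ∀ i, closurePoints Ginf ⊆ closurePoints (G i) :=
    fun i => closurePoints_anti fun b => (hGinf b i).le
  choose next hnext hltnext using exists_gt_mem_closurePoints h0 hI Ginf
  have : Nonempty Λ := Order.cof_ne_zero_iff.1 (bot_lt_of_lt h0).ne'
  obtain ⟨a₀⟩ := ‹Nonempty Λ›
  have hemono : StrictMono fun n : ℕ => next^[n] a₀ := strictMono_nat_of_lt_succ fun n => by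
    rw [Function.iterate_succ_apply']; exact hltnext _
  have hemem : ∀ n, next^[n + 1] a₀ ∈ closurePoints Ginf := fun n => by
    rw [Function.iterate_succ_apply']; exact hnext _
  obtain ⟨b, hb⟩ := exists_forall_lt_of_countable h0
    (Set.countable_range fun n : ℕ => next^[n] a₀)
  -- δ is a limit of points of all the clubs at once.
  obtain ⟨δ, hδ⟩ := exists_isLeast_of_nonempty
    (s := upperBounds (Set.range fun n : ℕ => next^[n] a₀)) ⟨b, fun x hx => (hb x hx).le⟩
  have hδ : IsLUB (Set.range fun n : ℕ => next^[n] a₀) δ := hδ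
  have hex : ∃ η : ℕ → Λ, StrictMono η ∧ IsLUB (Set.range η) δ := ⟨_, hemono, hδ⟩
  have hladder : StrictMono (ladder δ) ∧ IsLUB (Set.range (ladder δ)) δ := by
    simp only [ladder, dif_pos hex]
    exact hex.choose_spec
  obtain ⟨hη, hηδ⟩ := hladder
  have hηlt : ∀ n, ladder δ n < δ := fun n => (hη n.lt_succ_self).trans_le (hηδ.1 ⟨_, rfl⟩)
  have hacc : ∀ x < δ, ∃ e ∈ closurePoints Ginf, x < e ∧ e < δ := by
    intro x hx
    obtain ⟨_, ⟨n, rfl⟩, hn⟩ := (lt_isLUB_iff hδ).1 hx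
    exact ⟨_, hemem n, hn.trans (hemono n.lt_succ_self),
      (hemono (n + 1).lt_succ_self).trans_le (hδ.1 ⟨_, rfl⟩)⟩
  -- As the clubs shrink, each pushed-down rung can only descend, hence is eventually constant.
  obtain ⟨i, hi⟩ := exists_forall_ge_eq_of_antitone hWcof
    (fun n i => lastClosurePoint (G i) (ladder δ n)) fun n j k hjk =>
      (isGreatest_lastClosurePoint (G j) (ladder δ n)).2
        ⟨hGmono j k hjk (isGreatest_lastClosurePoint (G k) _).1.1,
          (isGreatest_lastClosurePoint (G k) _).1.2⟩
  have hsub : ∃ φ : ℕ → ℕ,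
      StrictMono ((fun n => lastClosurePoint (G i) (ladder δ n)) ∘ φ) := by
    refine exists_strictMono_comp_of_forall_exists_lt fun n => ?_
    obtain ⟨e, he, hne, heδ⟩ := hacc _ (hηlt n)
    obtain ⟨_, ⟨m, rfl⟩, hm⟩ := (lt_isLUB_iff hηδ).1 heδ
    refine ⟨m, hη.lt_iff_lt.1 (hne.trans hm), ?_⟩
    exact ((isGreatest_lastClosurePoint (G i) _).1.2.trans_lt hne).trans_le
      ((isGreatest_lastClosurePoint (G i) (ladder δ m)).2 ⟨hGinf' i he, hm.le⟩)
  have href : refined (G i) δ = (fun n => lastClosurePoint (G i) (ladder δ n)) ∘ hsub.choose := by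
    simp only [refined, dif_pos hsub]
  obtain ⟨n, hn⟩ := hH (G i) δ (href ▸ hsub.choose_spec)
  obtain ⟨j, hj⟩ := exists_forall_lt_of_countable hWcof (Set.countable_singleton i)
  have hij : i < j := hj i rfl
  apply hn
  rw [href]
  have := hi (hsub.choose n) j hij.le
  simp only [Function.comp]
  rw [← this]
  -- The stabilized rung is also the one computed from `G j`, so it lies in the club of `H (G i)`,
  -- which it was chosen to avoid.
  exact closurePoints_anti (fun b => (hG i j hij b).2) (isGreatest_lastClosurePoint (G j) _).1.1

/-- Club guessing, avoiding the least element. -/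
theorem exists_club_guessing_not_isMin (h1 : ℵ₁ < Order.cof Λ)
    (hI : ∀ a : Λ, #(Set.Iio a) < Order.cof Λ) :
    ∃ c : Λ → ℕ → Λ, ∀ g : Λ → Λ, ∃ δ, StrictMono (c δ) ∧
      ∀ n, c δ n ∈ closurePoints g ∧ ∃ b, b < c δ n := by
  obtain ⟨c, hc⟩ := exists_club_guessing h1 hI
  refine ⟨fun δ n => c δ (n + 1), fun g => ?_⟩
  obtain ⟨δ, hδ, hg⟩ := hc g
  exact ⟨δ, fun m n h => hδ (Nat.succ_lt_succ h), fun n => ⟨hg _, c δ n, hδ n.lt_succ_self⟩⟩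

end ClubGuessing

/-! ### The invariant and its monotonicity -/

section Coding

variable {Λ : Type u} [LinearOrder Λ]

/-- The distances of `x` to the sets of points of rank below `a n` are, up to a constant factor,
the powers `ρ ^ n`. -/
def ApproachRate {X : Type*} [MetricSpace X] (e : X → Λ) (a : ℕ → Λ) (x : X) (ρ : ℝ) : Prop :=
  ∃ K > 0, ∀ n, (∀ y, e y < a n → ρ ^ n ≤ K * dist x y) ∧ ∃ y, e y < a n ∧ dist x y ≤ K * ρ ^ n

theorem le_of_forall_pow_le_mul_pow {ρ σ C : ℝ} (hσ : 0 < σ)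
    (h : ∀ n : ℕ, ρ ^ n ≤ C * σ ^ n) : ρ ≤ σ := by
  by_contra! hlt
  obtain ⟨n, hn⟩ := pow_unbounded_of_one_lt C ((one_lt_div hσ).2 hlt)
  rw [div_pow, lt_div_iff₀ (pow_pos hσ n)] at hn
  exact (h n).not_gt hn

theorem ApproachRate.unique {X : Type*} [MetricSpace X] {e : X → Λ} {a : ℕ → Λ} {x : X} {ρ σ : ℝ}
    (hρ : 0 < ρ) (hσ : 0 < σ) (h : ApproachRate e a x ρ) (h' : ApproachRate e a x σ) : ρ = σ := by
  obtain ⟨K, hK, hKρ⟩ := h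
  obtain ⟨L, hL, hLσ⟩ := h'
  refine le_antisymm (le_of_forall_pow_le_mul_pow (C := K * L) hσ fun n => ?_)
    (le_of_forall_pow_le_mul_pow (C := L * K) hρ fun n => ?_)
  · obtain ⟨y, hy, hd⟩ := (hLσ n).2
    calc ρ ^ n ≤ K * dist x y := (hKρ n).1 y hy
      _ ≤ K * (L * σ ^ n) := by gcongr
      _ = K * L * σ ^ n := by ring
  · obtain ⟨y, hy, hd⟩ := (hKρ n).2
    calc σ ^ n ≤ L * dist x y := (hLσ n).1 y hy
      _ ≤ L * (K * ρ ^ n) := by gcongr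
      _ = L * K * ρ ^ n := by ring

/-- The family of sets `A` such that the rate `ρ A` is realized along guesses of every club. -/
def codedFamily {X : Type*} [MetricSpace X] (c : Λ → ℕ → Λ) (ρ : Set ℕ → ℝ) (e : X → Λ) :
    Set (Set ℕ) :=
  {A | ∀ g : Λ → Λ, ∃ δ, (∀ n, c δ n ∈ closurePoints g) ∧ ∃ x, ApproachRate e (c δ) x (ρ A)}

/-- Rates are unique, so sending A to a witnessing pair (δ, x) is injective. -/
theorem lift_mk_codedFamily_le {X : Type u} [MetricSpace X] (c : Λ → ℕ → Λ) {ρ : Set ℕ → ℝ}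
    (hρ : Function.Injective ρ) (hρ0 : ∀ A, 0 < ρ A) (e : X → Λ) :
    Cardinal.lift.{u} #(codedFamily c ρ e) ≤ #Λ * #X := by
  choose δ _ x hx using fun A : codedFamily c ρ e => A.2 id

  rw [Cardinal.mul_def, ← Cardinal.lift_uzero #(Λ × X)]
  refine Cardinal.lift_mk_le'.2 ⟨fun A => (δ A, x A), fun A B hAB => ?_⟩
  obtain ⟨h1, h2⟩ := Prod.ext_iff.1 hAB
  have hA := hx A
  rw [show δ A = δ B from h1, show x A = x B from h2] at hA
  exact Subtype.ext (hρ (hA.unique (hρ0 _) (hρ0 _) (hx B)))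

/-- Countably many points of `X` approximate the distances of `y` to all points of the range. -/
theorem exists_seq_dist_lt {X Y : Type*} [Nonempty X] [MetricSpace Y] (f : X → Y) (y : Y) :
    ∃ w : ℕ → X, ∀ x, ∀ ε > 0, ∃ m, dist y (f (w m)) < dist y (f x) + ε := by
  have hbdd : BddBelow (Set.range fun x => dist y (f x)) := ⟨0, by
    rintro _ ⟨x, rfl⟩
    exact dist_nonneg⟩
  have : ∀ m : ℕ, ∃ x, dist y (f x) < (⨅ x, dist y (f x)) + 1 / ((m : ℝ) + 1) := fun m =>
    exists_lt_of_ciInf_lt (lt_add_of_pos_right _ Nat.one_div_pos_of_nat)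
  choose w hw using this
  refine ⟨w, fun x ε hε => ?_⟩
  obtain ⟨m, hm⟩ := exists_nat_one_div_lt hε
  exact ⟨m, (hw m).trans_le (add_le_add (ciInf_le hbdd x) hm.le)⟩

theorem mk_setOf_equiv_le_lt_cof (h0 : ℵ₀ < Order.cof Λ)
    (hI : ∀ a : Λ, #(Set.Iio a) < Order.cof Λ) {X : Type u} (e : X ≃ Λ) (b : Λ) :
    #{x | e x ≤ b} < Order.cof Λ := by
  refine lt_of_le_of_lt ?_ (mk_Iic_lt_cof h0 hI b)
  exact Cardinal.mk_le_of_injective (f := fun x : {x | e x ≤ b} => (⟨e x.1, x.2⟩ : Set.Iic b))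
    fun x y h => Subtype.ext (e.injective (congrArg Subtype.val h))

/-- There is a club of ranks at which a map respects the rank filtrations, and at which the
distances to the range of the map are decided. -/
theorem exists_closing_function (h0 : ℵ₀ < Order.cof Λ)
    (hI : ∀ a : Λ, #(Set.Iio a) < Order.cof Λ) {X Y : Type u} [Nonempty X] [MetricSpace Y]
    (e : X ≃ Λ) (e' : Y ≃ Λ) (f : X → Y) :
    ∃ g : Λ → Λ, ∀ a ∈ closurePoints g, (∀ x, e x < a → e' (f x) < a) ∧
      ∀ y, e' y < a → ∀ x, ∀ ε > 0, ∃ x', e x' < a ∧ dist y (f x') < dist y (f x) + ε := by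
  choose w hw using exists_seq_dist_lt f
  have : ∀ b : Λ, ∃ b', ∀ z ∈ (fun x => e' (f x)) '' {x | e x ≤ b} ∪
      (fun p : Y × ULift.{u} ℕ => e (w p.1 p.2.down)) '' ({y | e' y ≤ b} ×ˢ Set.univ), z < b' := by
    intro b
    refine exists_forall_lt_of_mk_lt_cof ((Cardinal.mk_union_le _ _).trans_lt
      (Cardinal.add_lt_of_lt h0.le (Cardinal.mk_image_le.trans_lt
        (mk_setOf_equiv_le_lt_cof h0 hI e b)) (Cardinal.mk_image_le.trans_lt ?_)))
    rw [Cardinal.mk_setProd]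
    refine Cardinal.mul_lt_of_lt h0.le ?_ ?_
    · simpa using mk_setOf_equiv_le_lt_cof h0 hI e' b
    · simpa using h0
  choose g hg using this
  refine ⟨g, fun a ha => ⟨fun x hx => (hg _ _ (Or.inl ⟨x, le_rfl, rfl⟩)).trans (ha _ hx),
    fun y hy x ε hε => ?_⟩⟩
  obtain ⟨m, hm⟩ := hw y x ε hε
  exact ⟨w y m, (hg _ _ (Or.inr ⟨(y, ⟨m⟩), ⟨le_rfl, trivial⟩, rfl⟩)).trans (ha _ hy), hm⟩

theorem codedFamily_subset_of_biLipschitzEmbeddable (h0 : ℵ₀ < Order.cof Λ)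
    (hI : ∀ a : Λ, #(Set.Iio a) < Order.cof Λ) {X Y : Type u} [MetricSpace X] [MetricSpace Y]
    (e : X ≃ Λ) (e' : Y ≃ Λ) (c : Λ → ℕ → Λ) {ρ : Set ℕ → ℝ} (hρ0 : ∀ A, 0 < ρ A)
    (hXY : BiLipschitzEmbeddable X Y) : codedFamily c ρ e ⊆ codedFamily c ρ e' := by
  obtain ⟨L, f, hL, hf, hfd⟩ := hXY
  have hfd₁ : ∀ x x', dist (f x) (f x') ≤ L * dist x x' := fun x x' => by
    rcases eq_or_ne x x' with rfl | h
    · simp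
    · exact (hfd x x' h).1.le
  have hfd₂ : ∀ x x', dist x x' ≤ L * dist (f x) (f x') := fun x x' => by
    rcases eq_or_ne x x' with rfl | h
    · simp
    · exact (hfd x x' h).2.le
  intro A hA g
  have : Nonempty X := (hA (id : Λ → Λ)).choose_spec.2.nonempty
  obtain ⟨gf, hgf⟩ := exists_closing_function h0 hI e e' f
  -- The maximum guesses inside both clubs simultaneously.
  obtain ⟨δ, hδ, x, K, hK, hx⟩ := hA fun b : Λ => max (g b) (gf b)
  refine ⟨δ, fun n => closurePoints_anti (fun b => le_max_left (g b) (gf b)) (hδ n), f x,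
    max (4 * K * L) (L * K), lt_max_of_lt_right (mul_pos hL hK), fun n => ⟨fun y hy => ?_, ?_⟩⟩
  · have hpos : 0 < ρ A ^ n := pow_pos (hρ0 A) n
    -- This ε contributes K * L * ε = ρ(A)^n / 2 below, which the left side absorbs; hence the
    -- constant 4 * K * L.
    obtain ⟨x', hx', hd⟩ := (hgf _ (closurePoints_anti (fun b => le_max_right (g b) (gf b)) (hδ n))).2 y hy x
      (ρ A ^ n / (2 * K * L)) (by positivity)
    have h1 : ρ A ^ n ≤ K * (L * (2 * dist (f x) y + ρ A ^ n / (2 * K * L))) := by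
      calc ρ A ^ n ≤ K * dist x x' := (hx n).1 x' hx'
        _ ≤ K * (L * dist (f x) (f x')) := by gcongr; exact hfd₂ x x'
        _ ≤ K * (L * (2 * dist (f x) y + ρ A ^ n / (2 * K * L))) := by
          gcongr
          have := dist_triangle (f x) y (f x')
          rw [dist_comm y (f x)] at hd
          linarith
    have h2 : K * (L * (2 * dist (f x) y + ρ A ^ n / (2 * K * L))) =
        2 * K * L * dist (f x) y + ρ A ^ n / 2 := by
      field_simp
    calc ρ A ^ n ≤ 4 * K * L * dist (f x) y := by linarith
      _ ≤ _ := mul_le_mul_of_nonneg_right (le_max_left _ _) dist_nonneg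
  · obtain ⟨x', hx', hd⟩ := (hx n).2
    refine ⟨f x', (hgf _ (closurePoints_anti (fun b => le_max_right (g b) (gf b)) (hδ n))).1 x' hx', ?_⟩
    calc dist (f x) (f x') ≤ L * dist x x' := hfd₁ x x'
      _ ≤ L * (K * ρ A ^ n) := by gcongr
      _ = L * K * ρ A ^ n := by ring
      _ ≤ _ := mul_le_mul_of_nonneg_right (le_max_right _ _) (pow_pos (hρ0 A) n).le

end Coding

/-! ### The ultrametric sequence spaces -/

section SequenceSpace

variable {Λ : Type u}

open Classical in
/-- The distance of two sequences is a power of a number in `(0, 1)` that depends on the first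
entry. -/
noncomputable def seqDist (r : Λ → ℝ) (s t : ℕ → Λ) : ℝ :=
  if s = t then 0 else r (s 0) ^ PiNat.firstDiff s t

theorem seqDist_of_ne (r : Λ → ℝ) {s t : ℕ → Λ} (h : s ≠ t) :
    seqDist r s t = r (s 0) ^ PiNat.firstDiff s t := if_neg h

theorem seqDist_self (r : Λ → ℝ) (s : ℕ → Λ) : seqDist r s s = 0 := if_pos rfl

theorem seqDist_nonneg {r : Λ → ℝ} (hr0 : ∀ i, 0 < r i) (s t : ℕ → Λ) : 0 ≤ seqDist r s t := by
  rcases eq_or_ne s t with rfl | h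
  · rw [seqDist_self]
  · rw [seqDist_of_ne r h]
    exact (pow_pos (hr0 _) _).le

/-- If the first entries differ, the exponent is 0 and the base is irrelevant; otherwise the bases
agree. -/
theorem seqDist_comm (r : Λ → ℝ) (s t : ℕ → Λ) : seqDist r s t = seqDist r t s := by
  rcases eq_or_ne s t with rfl | h
  · rfl
  rw [seqDist_of_ne r h, seqDist_of_ne r h.symm, PiNat.firstDiff_comm t s]
  rcases Nat.eq_zero_or_pos (PiNat.firstDiff s t) with h0 | h0
  · simp [h0]
  · rw [PiNat.apply_eq_of_lt_firstDiff h0]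

theorem seqDist_le_max {r : Λ → ℝ} (hr0 : ∀ i, 0 < r i) (hr1 : ∀ i, r i < 1) (s t w : ℕ → Λ) :
    seqDist r s w ≤ max (seqDist r s t) (seqDist r t w) := by
  rcases eq_or_ne s w with rfl | hsw
  · rw [seqDist_self]
    exact le_max_of_le_left (seqDist_nonneg hr0 _ _)
  rcases eq_or_ne s t with rfl | hst
  · exact le_max_right _ _
  rcases eq_or_ne t w with rfl | htw
  · exact le_max_left _ _
  rw [seqDist_of_ne r hsw, seqDist_of_ne r hst, seqDist_of_ne r htw]
  rcases min_le_iff.1 (PiNat.min_firstDiff_le s t w hsw) with h | h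
  · exact le_max_of_le_left (pow_le_pow_of_le_one (hr0 _).le (hr1 _).le h)
  · refine le_max_of_le_right ?_
    rcases Nat.eq_zero_or_pos (PiNat.firstDiff t w) with h0 | h0
    · rw [h0, pow_zero]
      exact pow_le_one₀ (hr0 _).le (hr1 _).le
    · rw [PiNat.apply_eq_of_lt_firstDiff h0, PiNat.apply_eq_of_lt_firstDiff (h0.trans_le h)]
      exact pow_le_pow_of_le_one (hr0 _).le (hr1 _).le h

/-- The metric `seqDist` on a set of sequences. -/
@[reducible] noncomputable def seqMetricSpace {r : Λ → ℝ} (hr0 : ∀ i, 0 < r i)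
    (hr1 : ∀ i, r i < 1) (S : Set (ℕ → Λ)) : MetricSpace S where
  dist s t := seqDist r s t
  dist_self s := seqDist_self r s
  dist_comm s t := seqDist_comm r s t
  dist_triangle s t w := (seqDist_le_max hr0 hr1 s t w).trans
    (max_le_add_of_nonneg (seqDist_nonneg hr0 _ _) (seqDist_nonneg hr0 _ _))
  eq_of_dist_eq_zero {s t} h := by
    by_contra hne
    have hne' : (s : ℕ → Λ) ≠ t := fun h => hne (Subtype.ext h)
    have h : seqDist r s t = 0 := h
    rw [seqDist_of_ne r hne'] at h
    exact (pow_pos (hr0 _) _).ne' h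

/-- The sequence with first entry `i` that continues with `a`. -/
def consSeq (i : Λ) (a : ℕ → Λ) : ℕ → Λ
  | 0 => i
  | n + 1 => a n

/-- The finite sequences, padded with `o`, and all sequences `consSeq i (c δ)`. -/
def ladderSequences (o : Λ) (c : Λ → ℕ → Λ) : Set (ℕ → Λ) :=
  (Set.range fun (l : List Λ) n => l.getD n o) ∪
    Set.range fun p : Λ × Λ => consSeq p.1 (c p.2)

theorem mk_ladderSequences (hΛ : ℵ₀ ≤ #Λ) (o : Λ) (c : Λ → ℕ → Λ) :
    #(ladderSequences o c) = #Λ := by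
  refine le_antisymm ((Cardinal.mk_union_le _ _).trans (Cardinal.add_le_of_le hΛ ?_ ?_)) ?_
  · exact Cardinal.mk_range_le.trans ((Cardinal.mk_list_le_max Λ).trans (max_le hΛ le_rfl))
  · exact Cardinal.mk_range_le.trans (by rw [← Cardinal.mul_def, Cardinal.mul_eq_self hΛ])
  · refine Cardinal.mk_le_of_injective
      (f := fun i => (⟨_, Or.inl ⟨[i], rfl⟩⟩ : ladderSequences o c)) fun i j h => ?_
    simpa using congrFun (congrArg Subtype.val h) 0

variable [LinearOrder Λ]

theorem exists_lt_forall_mem_le {a : Λ} (ha : ∃ b, b < a) (l : List Λ) (hl : ∀ x ∈ l, x < a) :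
    ∃ b < a, ∀ x ∈ l, x ≤ b := by
  induction l with
  | nil => simpa using ha
  | cons y l ih =>
    obtain ⟨b, hb, h⟩ := ih fun x hx => hl x (List.mem_cons_of_mem _ hx)
    refine ⟨max b y, max_lt hb (hl y List.mem_cons_self), fun x hx => ?_⟩
    rcases List.mem_cons.1 hx with rfl | hx
    · exact le_max_right _ _
    · exact (h x hx).trans (le_max_left _ _)

theorem mk_lists_le_lt_cof (h0 : ℵ₀ < Order.cof Λ)
    (hI : ∀ a : Λ, #(Set.Iio a) < Order.cof Λ) (b : Λ) :
    #{l : List Λ | ∀ x ∈ l, x ≤ b} < Order.cof Λ := by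
  have : {l : List Λ | ∀ x ∈ l, x ≤ b} ⊆ Set.range (List.map ((↑) : Set.Iic b → Λ)) := by
    intro l hl
    rw [Set.range_list_map_coe]
    exact hl
  exact (Cardinal.mk_le_mk_of_subset this).trans_lt (Cardinal.mk_range_le.trans_lt
    ((Cardinal.mk_list_le_max _).trans_lt (max_lt h0 (mk_Iic_lt_cof h0 hI b))))

/-- There is a club of ranks `a` such that the sequences of rank below `a` have entries below `a`
and include all padded finite sequences with entries below `a`. -/
theorem exists_closing_function_ladderSequences (h0 : ℵ₀ < Order.cof Λ)
    (hI : ∀ a : Λ, #(Set.Iio a) < Order.cof Λ) (o : Λ) (c : Λ → ℕ → Λ)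
    (e : ladderSequences o c ≃ Λ) :
    ∃ g : Λ → Λ, ∀ a ∈ closurePoints g, (∃ b, b < a) → (∀ t, e t < a → ∀ n, t.1 n < a) ∧
      ∀ l : List Λ, (∀ x ∈ l, x < a) → e ⟨fun n => l.getD n o, Or.inl ⟨l, rfl⟩⟩ < a := by
  have : ∀ b : Λ, ∃ b', ∀ z ∈ (fun p : ladderSequences o c × ULift.{u} ℕ => p.1.1 p.2.down) ''
      ({t | e t ≤ b} ×ˢ Set.univ) ∪
      (fun l : List Λ => e ⟨fun n => l.getD n o, Or.inl ⟨l, rfl⟩⟩) '' {l | ∀ x ∈ l, x ≤ b},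
      z < b' := by
    intro b
    refine exists_forall_lt_of_mk_lt_cof ((Cardinal.mk_union_le _ _).trans_lt
      (Cardinal.add_lt_of_lt h0.le (Cardinal.mk_image_le.trans_lt ?_)
        (Cardinal.mk_image_le.trans_lt (mk_lists_le_lt_cof h0 hI b))))
    rw [Cardinal.mk_setProd]
    refine Cardinal.mul_lt_of_lt h0.le ?_ ?_
    · simpa using mk_setOf_equiv_le_lt_cof h0 hI e b
    · simpa using h0
  choose g hg using this
  refine ⟨g, fun a ha hmin => ⟨fun t ht n => ?_, fun l hl => ?_⟩⟩
  · exact (hg _ _ (Or.inl ⟨(t, ⟨n⟩), ⟨le_rfl, trivial⟩, rfl⟩)).trans (ha _ ht)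
  · obtain ⟨b, hb, hlb⟩ := exists_lt_forall_mem_le hmin l hl
    exact (hg b _ (Or.inr ⟨l, hlb, rfl⟩)).trans (ha b hb)

/-- The witness is i followed by `c δ`. A sequence of rank below `c δ n` has entries below it, so it
differs from the witness by index n + 1; the first n + 1 entries, padded, have rank below `c δ n`.
The factor r⁻¹ absorbs the shift. -/
theorem mem_codedFamily_ladderSequences (h0 : ℵ₀ < Order.cof Λ)
    (hI : ∀ a : Λ, #(Set.Iio a) < Order.cof Λ) (o : Λ) {c : Λ → ℕ → Λ}
    (hc : ∀ g : Λ → Λ, ∃ δ, StrictMono (c δ) ∧ ∀ n, c δ n ∈ closurePoints g ∧ ∃ b, b < c δ n)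
    {ρ : Set ℕ → ℝ} (hρ0 : ∀ A, 0 < ρ A) (hρ1 : ∀ A, ρ A < 1) (φ : Λ → Set ℕ)
    [MetricSpace (ladderSequences o c)]
    (hd : ∀ s t : ladderSequences o c, dist s t = seqDist (fun i => ρ (φ i)) s t)
    (e : ladderSequences o c ≃ Λ) (i : Λ) : φ i ∈ codedFamily c ρ e := by
  intro g
  obtain ⟨gl, hgl⟩ := exists_closing_function_ladderSequences h0 hI o c e
  -- Including i in the maximum puts every non-minimal closure point above i, so i may be an entry
  -- of the approximating sequences.
  obtain ⟨δ, hmono, hδ⟩ := hc fun b => max (g b) (max (gl b) i)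
  have hcl := fun n => hgl (c δ n) (closurePoints_anti
    (fun b => (le_max_left (gl b) i).trans (le_max_right (g b) _)) (hδ n).1) (hδ n).2
  have hi : ∀ n, i < c δ n := fun n => by
    obtain ⟨hn, b, hb⟩ := hδ n
    exact ((le_max_right _ _).trans (le_max_right _ _)).trans_lt (hn b hb)
  set r := ρ (φ i) with hr
  have hr0 : 0 < r := hρ0 _
  have hr1 : r < 1 := hρ1 _
  refine ⟨δ, fun n => closurePoints_anti (fun b => le_max_left (g b) (max (gl b) i)) (hδ n).1,
    ⟨consSeq i (c δ), Or.inr ⟨(i, δ), rfl⟩⟩, r⁻¹, inv_pos.2 hr0, fun n => ⟨fun y hy => ?_, ?_⟩⟩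
  · have hlt : y.1 (n + 1) < consSeq i (c δ) (n + 1) := (hcl n).1 y hy (n + 1)
    have hne : consSeq i (c δ) ≠ y := fun h => hlt.ne (congrFun h (n + 1)).symm
    have hle : PiNat.firstDiff (consSeq i (c δ)) y ≤ n + 1 := by
      by_contra! h
      exact hlt.ne (PiNat.apply_eq_of_lt_firstDiff h).symm
    rw [hd, seqDist_of_ne _ hne, le_inv_mul_iff₀ hr0, ← pow_succ']
    exact pow_le_pow_of_le_one hr0.le hr1.le hle
  · refine ⟨_, (hcl n).2 ((List.range (n + 1)).map (consSeq i (c δ))) ?_, ?_⟩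
    · intro x hx
      obtain ⟨k, hk, rfl⟩ := List.mem_map.1 hx
      rw [List.mem_range] at hk
      cases k with
      | zero => exact hi n
      | succ k => exact hmono (by omega)
    · have hone : r ^ n ≤ r⁻¹ * r ^ n :=
        le_mul_of_one_le_left (pow_pos hr0 n).le ((one_le_inv₀ hr0).2 hr1.le)
      refine le_trans ?_ hone
      rw [hd]
      set y : ℕ → Λ := fun m => ((List.range (n + 1)).map (consSeq i (c δ))).getD m o with hy
      rcases eq_or_ne (consSeq i (c δ)) y with h | h
      · change seqDist _ (consSeq i (c δ)) y ≤ _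
        rw [← h, seqDist_self]
        exact (pow_pos hr0 n).le
      · change seqDist _ (consSeq i (c δ)) y ≤ _
        rw [seqDist_of_ne _ h]
        refine pow_le_pow_of_le_one hr0.le hr1.le ?_
        by_contra! hlt
        refine PiNat.apply_firstDiff_ne h ?_
        generalize PiNat.firstDiff (consSeq i (c δ)) y = m at hlt
        simp [hy, List.getD, List.getElem?_range (show m < n + 1 by omega)]

end SequenceSpace

/-! ### Assembling the map -/

theorem exists_injective_set_nat_unitInterval :
    ∃ ρ : Set ℕ → ℝ, Function.Injective ρ ∧ (∀ A, 0 < ρ A) ∧ ∀ A, ρ A < 1 := by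
  have : #(Set ℕ) = #(Set.Ioo (0 : ℝ) 1) := by
    rw [Cardinal.mk_Ioo_real zero_lt_one, Cardinal.mk_set, Cardinal.mk_nat,
      Cardinal.two_power_aleph0]
  obtain ⟨f⟩ := Cardinal.eq.1 this
  exact ⟨fun A => f A, Subtype.val_injective.comp f.injective, fun A => (f A).2.1,
    fun A => (f A).2.2⟩

theorem exists_subset_range_of_lift_mk_le {α : Type} {Λ : Type u} [Nonempty α] {S : Set α}
    (hS : Cardinal.lift.{u} #S ≤ #Λ) : ∃ φ : Λ → α, S ⊆ Set.range φ := by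
  rw [← Cardinal.lift_uzero #Λ] at hS
  obtain ⟨j⟩ := Cardinal.lift_mk_le'.1 hS
  obtain ⟨a⟩ := ‹Nonempty α›
  exact ⟨Function.extend j Subtype.val fun _ => a,
    fun s hs => ⟨j ⟨s, hs⟩, j.injective.extend_apply _ _ _⟩⟩

/-- The ultrametric space of the sequences that follow `c`, as a space of cardinality `κ`. -/
noncomputable def ladderSpace {κ : Cardinal.{u}} {Λ : Type u} {r : Λ → ℝ} (hr0 : ∀ i, 0 < r i)
    (hr1 : ∀ i, r i < 1) (hκ : ℵ₀ ≤ κ) (hΛ : #Λ = κ) (o : Λ) (c : Λ → ℕ → Λ) :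
    MetricSpaceOfCard κ where
  carrier := ladderSequences o c
  metric := seqMetricSpace hr0 hr1 _
  card_eq := (mk_ladderSequences (hΛ ▸ hκ) o c).trans hΛ

theorem isUltrametricDist_ladderSpace {κ : Cardinal.{u}} {Λ : Type u} {r : Λ → ℝ}
    (hr0 : ∀ i, 0 < r i) (hr1 : ∀ i, r i < 1) (hκ : ℵ₀ ≤ κ) (hΛ : #Λ = κ) (o : Λ)
    (c : Λ → ℕ → Λ) : IsUltrametricDist (ladderSpace hr0 hr1 hκ hΛ o c).carrier :=
  ⟨fun s t w => seqDist_le_max hr0 hr1 s.1 t.1 w.1⟩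

theorem mainTheorem10 (κ : Cardinal.{u}) (hreg : κ.IsRegular) (hκ : ℵ₁ < κ) :
    ∃ F : MetricTypes κ → RealFamilies κ,
      Monotone F ∧ IsCofinal (F '' ultrametricTypes κ) := by
  let Λ := κ.ord.ToType
  have hcof : Order.cof Λ = κ := by rw [Ordinal.cof_toType, hreg.cof_ord]
  have hΛ : #Λ = κ := Cardinal.mk_ord_toType κ
  have h1 : ℵ₁ < Order.cof Λ := by rwa [hcof]
  have h0 : ℵ₀ < Order.cof Λ := Cardinal.aleph0_lt_aleph_one.trans h1
  have hI : ∀ a : Λ, #(Set.Iio a) < Order.cof Λ := fun a => by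
    rw [hcof]
    exact (Cardinal.mk_Iio_lt a (by rw [hΛ, Ordinal.type_toType])).trans_eq hΛ
  obtain ⟨c, hc⟩ := exists_club_guessing_not_isMin h1 hI
  obtain ⟨ρ, hρ, hρ0, hρ1⟩ := exists_injective_set_nat_unitInterval
  have hequiv : ∀ X : MetricSpaceOfCard κ, Nonempty (X.carrier ≃ Λ) := fun X =>
    Cardinal.eq.1 (X.card_eq.trans hΛ.symm)
  let e := fun X => (hequiv X).some
  -- The choices of representative and enumeration are harmless: monotonicity holds for arbitrary
  -- enumerations of both spaces.
  let F : MetricTypes κ → RealFamilies κ := fun m => ⟨codedFamily c ρ (e (Quotient.out m)), by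
    refine (lift_mk_codedFamily_le c hρ hρ0 _).trans ?_
    rw [hΛ, (Quotient.out m).card_eq, Cardinal.mul_eq_self hreg.aleph0_le]⟩
  refine ⟨F, fun m m' hm => ?_, fun S => ?_⟩
  · rw [← Quotient.out_eq m, ← Quotient.out_eq m'] at hm
    exact codedFamily_subset_of_biLipschitzEmbeddable h0 hI _ _ c hρ0
      ((MetricSpaceOfCard.isometryType_le_iff _ _).1 hm)
  · obtain ⟨φ, hφ⟩ := exists_subset_range_of_lift_mk_le (Λ := Λ) (S.2.trans_eq hΛ.symm)
    obtain ⟨o⟩ : Nonempty Λ := Order.cof_ne_zero_iff.1 (bot_lt_of_lt h0).ne'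
    let X : MetricSpaceOfCard κ := ladderSpace (r := fun i => ρ (φ i)) (fun i => hρ0 _)
      (fun i => hρ1 _) hreg.aleph0_le hΛ o c
    refine ⟨F X.isometryType, ⟨_, ⟨X, isUltrametricDist_ladderSpace _ _ _ _ _ _, rfl⟩, rfl⟩,
      fun A hA => ?_⟩
    obtain ⟨i, rfl⟩ := hφ hA
    have hout : (Quotient.out X.isometryType).isometryType = X.isometryType := Quotient.out_eq _
    have hX : BiLipschitzEmbeddable X.carrier (Quotient.out X.isometryType).carrier :=
      (MetricSpaceOfCard.isometryType_le_iff _ _).1 hout.ge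
    refine codedFamily_subset_of_biLipschitzEmbeddable h0 hI (e X) _ c hρ0 hX ?_
    let : MetricSpace (ladderSequences o c) := X.metric
    exact mem_codedFamily_ladderSequences h0 hI o hc hρ0 hρ1 φ (fun _ _ => rfl) (e X) i
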